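/- Let $M\ge 1$ and consider the linear system $x_{t+1}=Ax_t+w_t$ in $\mathbb R^M$, $t=0,1,2,\dots$, where $A$ is a diagonal matrix with $a_{jj}\ge 1$ for all $j$, the noise vectors $w_0,w_1,\dots$ are independent and identically distributed with law $\mathcal N(0,Q)$, and $Q$ is positive definite. The initial state $x_0$ is square integrable, the monitor knows an initial estimate $\hat x_{\mathrm{init}}$ of it (a constant or a random vector), and the pair $(x_0,\hat x_{\mathrm{init}})$ is independent of the noise. In every slot $t\ge 0$ one sensor $\pi(t)\in\{1,\dots,M\}$ is scheduled, and the monitor receives the sample $y_t=x_t^{\pi(t)}$. The scheduling policy $\pi$ is causal and oblivious and may be randomized: $\pi(t)$ is a measurable function of $\hat x_{\mathrm{init}}$, of the earlier decisions $\pi(0),\dots,\pi(t-1)$ and samples $y_0,\dots,y_{t-1}$, and of a random seed that is independent of the initial data and the noise. Let $\hat x_t$ be the minimum mean square error estimate of the state, i.e. the conditional expectation of $x_t$ given $\hat x_{\mathrm{init}}$, $\pi(0),\dots,\pi(t)$ and $y_0,\dots,y_t$. Let $h_i(t)$ be the age of information of sensor $i$: $h_i(0)=0$, and for $t\ge 1$,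 $h_i(t)=0$ if $\pi(t)=i$ and $h_i(t)=h_i(t-1)+1$ otherwise. Put $\tilde q_{ii}=q_{ii}-\mathbf q_i^{T}Q_{-i}^{-1}\mathbf q_i$, where $q_{ii}$ is the $i$-th diagonal entry of $Q$, $\mathbf q_i\in\mathbb R^{M-1}$ is the vector of the covariances $q_{ji}$, $j\ne i$, and $Q_{-i}$ is $Q$ without its $i$-th row and column (for $M=1$, $\tilde q_{ii}=q_{ii}$). Then for every such policy $\pi$, every $i\in\{1,\dots,M\}$ and every $t\ge 0$, the expectations below are finite and $$\mathbb E_\pi\big[(x_t^i-\hat x_t^i)^2\big]\;\ge\;\tilde q_{ii}\,\mathbb E_\pi\Big[\sum_{k=0}^{h_i(t)-1}a_{ii}^{2k}\Big]=\begin{cases}\tilde q_{ii}\,\mathbb E_\pi[h_i(t)], & a_{ii}=1,\\[1mm] \tilde q_{ii}\,\mathbb E_\pi\Big[\dfrac{a_{ii}^{2h_i(t)}-1}{a_{ii}^2-1}\Big], & a_{ii}>1,\end{cases}$$ where the sum is empty (zero) when $h_i(t)=0$. -/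

import Mathlib

open MeasureTheory ProbabilityTheory

namespace Monitoring

noncomputable section

/-- The state process of the linear system `x_{t+1} = A x_t + w_t` started at `x₀`. -/
def state {Ω : Type*} {M : ℕ} (A : Matrix (Fin M) (Fin M) ℝ)
    (x₀ : Ω → EuclideanSpace ℝ (Fin M)) (w : ℕ → Ω → EuclideanSpace ℝ (Fin M)) :
    ℕ → Ω → EuclideanSpace ℝ (Fin M)
  | 0 => x₀
  | t + 1 => fun ω => WithLp.toLp 2 (A.mulVec (state A x₀ w t ω).ofLp) + w t ω

/-- A causal oblivious scheduling policy for `M` sensors, possibly randomized. The sensor scheduled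
in slot `t` is a measurable function of a randomization seed with values in `𝒱`, of the initial
estimate, and of the sensors scheduled and the samples received in the slots `0, …, t - 1`. -/
structure ObliviousPolicy (M : ℕ) (𝒱 : Type*) [MeasurableSpace 𝒱] where
  rule : (t : ℕ) → 𝒱 × EuclideanSpace ℝ (Fin M) × (Fin t → Fin M × ℝ) → Fin M
  measurable_rule : ∀ t : ℕ, Measurable (rule t)

section Policy

variable {Ω 𝒱 : Type*} [MeasurableSpace 𝒱] {M : ℕ}

/-- What the monitor has received before slot `t` when the process `x` is sampled according to `π`:
for every `s < t`, the index of the scheduled sensor and the received sample, which is the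
coordinate of `x s` at that index. -/
def history (π : ObliviousPolicy M 𝒱) (V : Ω → 𝒱) (xinit : Ω → EuclideanSpace ℝ (Fin M))
    (x : ℕ → Ω → EuclideanSpace ℝ (Fin M)) : (t : ℕ) → Ω → Fin t → Fin M × ℝ
  | 0 => fun _ => Fin.elim0
  | t + 1 => fun ω =>
      Fin.snoc (α := fun _ => Fin M × ℝ) (history π V xinit x t ω)
        (π.rule t (V ω, xinit ω, history π V xinit x t ω),
          x t ω (π.rule t (V ω, xinit ω, history π V xinit x t ω)))

/-- The sensor scheduled in slot `t`. -/
def scheduled (π : ObliviousPolicy M 𝒱) (V : Ω → 𝒱) (xinit : Ω → EuclideanSpace ℝ (Fin M))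
    (x : ℕ → Ω → EuclideanSpace ℝ (Fin M)) (t : ℕ) (ω : Ω) : Fin M :=
  π.rule t (V ω, xinit ω, history π V xinit x t ω)

/-- The age of information of sensor `i`: it starts at `0`, it is `0` in a slot in which `i` is
scheduled, and it grows by one in every other slot. -/
def age (π : ObliviousPolicy M 𝒱) (V : Ω → 𝒱) (xinit : Ω → EuclideanSpace ℝ (Fin M))
    (x : ℕ → Ω → EuclideanSpace ℝ (Fin M)) (i : Fin M) : ℕ → Ω → ℕ
  | 0 => fun _ => 0
  | t + 1 => fun ω =>
      if scheduled π V xinit x (t + 1) ω = i then 0 else age π V xinit x i t ω + 1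

/-- The information of the monitor at time `t`: the σ-algebra generated by the initial estimate and
by the scheduling decisions and received samples of the slots `0, …, t`. -/
@[reducible] def info (π : ObliviousPolicy M 𝒱) (V : Ω → 𝒱) (xinit : Ω → EuclideanSpace ℝ (Fin M))
    (x : ℕ → Ω → EuclideanSpace ℝ (Fin M)) (t : ℕ) : MeasurableSpace Ω :=
  MeasurableSpace.comap (fun ω => (xinit ω, history π V xinit x (t + 1) ω)) inferInstance

/-- The `i`-th coordinate of the MMSE estimate at time `t`: the conditional expectation of the
`i`-th coordinate of the state given the information of the monitor. -/
def estimate [MeasurableSpace Ω] (μ : Measure Ω) (π : ObliviousPolicy M 𝒱) (V : Ω → 𝒱)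
    (xinit : Ω → EuclideanSpace ℝ (Fin M)) (x : ℕ → Ω → EuclideanSpace ℝ (Fin M)) (t : ℕ)
    (i : Fin M) : Ω → ℝ :=
  condExp (info π V xinit x t) μ (fun ω => x t ω i)

end Policy

/-- The Schur complement `q̃ᵢᵢ = qᵢᵢ - qᵢᵀ Q₋ᵢ⁻¹ qᵢ`, where `qᵢ` is the `i`-th column of `Q` without
its `i`-th entry and `Q₋ᵢ` is `Q` without its `i`-th row and column. -/
def qTilde {M : ℕ} (Q : Matrix (Fin M) (Fin M) ℝ) (i : Fin M) : ℝ :=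
  Q i i - dotProduct (fun j : {j : Fin M // j ≠ i} => Q j i)
    ((Q.submatrix (fun j : {j : Fin M // j ≠ i} => (j : Fin M))
      (fun j : {j : Fin M // j ≠ i} => (j : Fin M)))⁻¹.mulVec
        (fun j : {j : Fin M // j ≠ i} => Q j i))

end

end Monitoring

namespace Monitoring

open scoped Matrix

/-! ### Regression of one coordinate of a Gaussian vector on the others -/

/-! Regress the `i`-th noise coordinate on the others. The regression residual `⟪p, w s⟫`, the
innovation of sensor `i`, is centered with variance `qTilde Q i`, and since the noise is Gaussian it
is independent of all other coordinates, hence of everything else in the model (`indep_innovation`).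
Fix `n` and delete these innovations from slot `τ = t - n` on. As `A` is diagonal, only coordinate
`i` changes, and only after slot `τ`. On the event `E` that the age is `n`, sensor `i` is not
sampled after `τ`, so the monitor sees the same data in both systems, and the modified system yields
the same event (`history_eq_and_age_eq`). Thus on `E` the error is a term `U` from the modified
system plus a weighted sum of the deleted innovations, each independent of `U`, `E` and the other
innovations. All cross terms vanish (`setIntegral_add_sum_sq_of_indep`). Dropping `U ^ 2` and
summing over `n` gives the bound. -/

lemma exists_mulVec_eq_single_qTilde {M : ℕ} {Q : Matrix (Fin M) (Fin M) ℝ} (hQ : Q.PosDef)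
    (i : Fin M) :
    ∃ p : EuclideanSpace ℝ (Fin M), p i = 1 ∧ Q *ᵥ p.ofLp = Pi.single i (qTilde Q i) := by
  set S := Q.submatrix (fun j : {j : Fin M // j ≠ i} => (j : Fin M))
      (fun j : {j : Fin M // j ≠ i} => (j : Fin M)) with hS
  set q : {j : Fin M // j ≠ i} → ℝ := fun j => Q j i with hq
  set b := S⁻¹ *ᵥ q with hb
  have hSb : S *ᵥ b = q := by
    have hu : IsUnit S.det :=
      (Matrix.isUnit_iff_isUnit_det S).1 (hQ.submatrix Subtype.val_injective).isUnit
    rw [hb, Matrix.mulVec_mulVec, Matrix.mul_nonsing_inv _ hu, Matrix.one_mulVec]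
  -- `b` holds the regression coefficients, so pairing with `p` gives the regression residual. The
  -- rows `k ≠ i` of `Q *ᵥ p` vanish by the normal equations, and row `i` is the Schur complement.
  set p : Fin M → ℝ := fun j => if hj : j = i then 1 else -b ⟨j, hj⟩ with hp
  have hsum : ∀ k, (Q *ᵥ p) k = Q k i - ∑ j : {j : Fin M // j ≠ i}, Q k j * b j := by
    intro k
    have h1 : (Q *ᵥ p) k = ∑ j, Q k j * p j := rfl
    rw [h1, Fintype.sum_eq_add_sum_subtype_ne _ i, sub_eq_add_neg, ← Finset.sum_neg_distrib]
    congr 1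
    · simp [hp]
    · exact Finset.sum_congr rfl fun j _ => by simp [hp, j.2]
  refine ⟨WithLp.toLp 2 p, by simp [hp], ?_⟩
  ext k
  rw [hsum]
  by_cases hk : k = i
  · subst hk
    have hsymm : ∀ j, Q k j = Q j k := fun j => by simpa using (hQ.1.apply k j).symm
    simp [qTilde, dotProduct, ← hS, ← hq, ← hb]
    exact Finset.sum_congr rfl fun j _ => by rw [hsymm]
  · have h2 : ∑ j : {j : Fin M // j ≠ i}, Q k j * b j = Q k i := congrFun hSb ⟨k, hk⟩
    rw [h2, sub_self, Pi.single_eq_of_ne hk]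

/-- `z` with its `i`-th coordinate lowered by `⟪p, z⟫`. -/
noncomputable def residual {M : ℕ} (p : EuclideanSpace ℝ (Fin M)) (i : Fin M) :
    EuclideanSpace ℝ (Fin M) →L[ℝ] EuclideanSpace ℝ (Fin M) :=
  ContinuousLinearMap.id ℝ _ - (innerSL ℝ p).smulRight (EuclideanSpace.single i 1)

lemma residual_apply {M : ℕ} (p : EuclideanSpace ℝ (Fin M)) (i : Fin M)
    (z : EuclideanSpace ℝ (Fin M)) :
    residual p i z = z - inner ℝ p z • EuclideanSpace.single i 1 := by
  simp [residual]

section Gaussian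

variable {Ω : Type*} [MeasurableSpace Ω] {μ : Measure Ω} {M : ℕ} {Q : Matrix (Fin M) (Fin M) ℝ}
  {W : Ω → EuclideanSpace ℝ (Fin M)} {p : EuclideanSpace ℝ (Fin M)} {i : Fin M} {c : ℝ}

lemma hasGaussianLaw_of_map_eq (hW : Measurable W) (hlaw : μ.map W = multivariateGaussian 0 Q) :
    HasGaussianLaw W μ :=
  HasLaw.hasGaussianLaw (μ := multivariateGaussian 0 Q) ⟨hW.aemeasurable, hlaw⟩

lemma covariance_inner_inner_of_map_eq (hQ : Q.PosSemidef) (hW : Measurable W)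
    (hlaw : μ.map W = multivariateGaussian 0 Q) (y z : EuclideanSpace ℝ (Fin M)) :
    cov[fun ω => inner ℝ y (W ω), fun ω => inner ℝ z (W ω); μ] = y ⬝ᵥ Q *ᵥ z := by
  have : IsFiniteMeasure (μ.map W) := by rw [hlaw]; infer_instance
  rw [← covarianceBilin_multivariateGaussian (μ := 0) hQ, ← hlaw,
    covarianceBilin_apply_eq_cov, covariance_map_fun]
  · exact Measurable.aestronglyMeasurable (by fun_prop)
  · exact Measurable.aestronglyMeasurable (by fun_prop)
  · exact hW.aemeasurable
  · rw [hlaw]; exact IsGaussian.memLp_two_id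

/-- The two are jointly Gaussian, so zero covariance suffices. Pairing the residual with `y` pairs
`W` with `y - y i • p`, whose `i`-th coordinate is zero because `p i = 1`, while `Q *ᵥ p` is
supported at `i`. -/
lemma indepFun_inner_residual (hQ : Q.PosSemidef) (hpi : p i = 1)
    (hp : Q *ᵥ p.ofLp = Pi.single i c) (hW : Measurable W)
    (hlaw : μ.map W = multivariateGaussian 0 Q) :
    IndepFun (fun ω => inner ℝ p (W ω)) (fun ω => residual p i (W ω)) μ := by
  have hG : HasGaussianLaw (fun ω => (inner ℝ p (W ω), residual p i (W ω))) μ :=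
    (hasGaussianLaw_of_map_eq hW hlaw).map_fun ((innerSL ℝ p).prod (residual p i))
  refine hG.indepFun_of_covariance_inner fun a y => ?_
  have h1 : ∀ ω, inner ℝ a (inner ℝ p (W ω)) = inner ℝ (a • p) (W ω) := fun ω => by
    simp [inner_smul_left, mul_comm]
  have h2 : ∀ ω, inner ℝ y (residual p i (W ω)) = inner ℝ (y - y i • p) (W ω) := fun ω => by
    rw [residual_apply, inner_sub_right, inner_sub_left, inner_smul_right, inner_smul_left,
      EuclideanSpace.inner_single_right]
    simp [mul_comm]
  simp_rw [h1, h2]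
  rw [covariance_comm, covariance_inner_inner_of_map_eq hQ hW hlaw]
  simp [Matrix.mulVec_smul, hp, hpi]

lemma memLp_inner_of_map_eq (hW : Measurable W) (hlaw : μ.map W = multivariateGaussian 0 Q)
    (p : EuclideanSpace ℝ (Fin M)) : MemLp (fun ω => inner ℝ p (W ω)) 2 μ :=
  ((hasGaussianLaw_of_map_eq hW hlaw).map_fun (innerSL ℝ p)).memLp_two

lemma integral_inner_of_map_eq (hW : Measurable W) (hlaw : μ.map W = multivariateGaussian 0 Q)
    (p : EuclideanSpace ℝ (Fin M)) : ∫ ω, inner ℝ p (W ω) ∂μ = 0 := by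
  rw [integral_inner (hasGaussianLaw_of_map_eq hW hlaw).integrable]
  have := integral_map (μ := μ) hW.aemeasurable
    (f := fun z : EuclideanSpace ℝ (Fin M) => z) (by fun_prop)
  rw [hlaw, integral_id_multivariateGaussian] at this
  rw [← this, inner_zero_right]

lemma integral_inner_sq_of_map_eq (hQ : Q.PosSemidef) (hpi : p i = 1)
    (hp : Q *ᵥ p.ofLp = Pi.single i c) (hW : Measurable W)
    (hlaw : μ.map W = multivariateGaussian 0 Q) : ∫ ω, inner ℝ p (W ω) ^ 2 ∂μ = c := by
  have h := covariance_inner_inner_of_map_eq hQ hW hlaw p p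
  rw [covariance, integral_inner_of_map_eq hW hlaw] at h
  simpa [hp, hpi, ← sq] using h

end Gaussian

/-! ### Independence of one noise component from everything else -/

section Independence

variable {Ω : Type*} {mΩ : MeasurableSpace Ω} {μ : Measure Ω}

/-- Reassociate the product of the three laws. This appends one more block to the data of which `X`
is independent. -/
lemma IndepFun.prodMk_right_of_prodMk_left [IsProbabilityMeasure μ] {α β γ : Type*}
    [MeasurableSpace α] [MeasurableSpace β] [MeasurableSpace γ] {X : Ω → α} {Y : Ω → β} {Z : Ω → γ}
    (hX : Measurable X) (hY : Measurable Y) (hZ : Measurable Z) (hXY : IndepFun X Y μ)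
    (hXYZ : IndepFun (fun ω => (X ω, Y ω)) Z μ) : IndepFun X (fun ω => (Y ω, Z ω)) μ := by
  have := Measure.isProbabilityMeasure_map (μ := μ) hX.aemeasurable
  have := Measure.isProbabilityMeasure_map (μ := μ) hY.aemeasurable
  have := Measure.isProbabilityMeasure_map (μ := μ) hZ.aemeasurable
  have hYZ : IndepFun Y Z μ := hXYZ.comp measurable_snd measurable_id
  rw [indepFun_iff_map_prod_eq_prod_map_map (by fun_prop) (by fun_prop)] at hXYZ hXY hYZ ⊢
  have h := congrArg (Measure.map MeasurableEquiv.prodAssoc) hXYZ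
  rw [Measure.map_map (MeasurableEquiv.measurable _) (by fun_prop), hXY,
    Measure.prodAssoc_prod, ← hYZ] at h
  exact h

lemma iIndepFun.indepFun_compl {E : Type*} [MeasurableSpace E] {w : ℕ → Ω → E}
    (hw : ∀ t, Measurable (w t)) (h : iIndepFun w μ) (s : ℕ) :
    IndepFun (w s) (fun ω (u : {u : ℕ // u ≠ s}) => w u ω) μ := by
  have h1 := indep_iSup_of_disjoint (fun t => (hw t).comap_le) h
    (S := {s}) (T := {s}ᶜ) disjoint_compl_right
  refine indep_of_indep_of_le_left (indep_of_indep_of_le_right h1 ?_) ?_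
  · refine Measurable.comap_le (@measurable_pi_lambda _ _ _ (_) _ _ fun u => ?_)
    exact (comap_measurable (w u)).mono (le_iSup₂_of_le (u : ℕ) (by simpa using u.2) le_rfl) le_rfl
  · simp

end Independence

/-! ### Adding independent centered terms -/

section SecondMoment

variable {Ω : Type*} {D mΩ : MeasurableSpace Ω} {μ : Measure Ω}

/-- `E.indicator F` is `D`-measurable and `v` is centered and independent of `D`, so the cross term
vanishes. Square integrability of `F` is required on `E` only, which is all that is available for
`U`. -/
lemma setIntegral_add_mul_sq_of_indep [IsProbabilityMeasure μ] {F v : Ω → ℝ} {E : Set Ω}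
    {q : ℝ} (c : ℝ) (hD : D ≤ mΩ) (hind : Indep (MeasurableSpace.comap v inferInstance) D μ)
    (hv : MemLp v 2 μ) (hv0 : ∫ ω, v ω ∂μ = 0) (hvq : ∫ ω, v ω ^ 2 ∂μ = q)
    (hE : MeasurableSet[D] E) (hF : Measurable[D] F) (hF2 : MemLp F 2 (μ.restrict E)) :
    ∫ ω in E, (F ω + c * v ω) ^ 2 ∂μ = ∫ ω in E, F ω ^ 2 ∂μ + c ^ 2 * (μ.real E * q) := by
  have hEm : MeasurableSet E := hD _ hE
  have key : ∀ G : Ω → ℝ, Measurable[D] G → IndepFun (E.indicator G) v μ := fun G hG =>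
    indep_of_indep_of_le_left hind.symm (hG.indicator hE).comap_le
  have hcross : ∫ ω in E, F ω * v ω ∂μ = 0 := by
    have h := (key F hF).integral_mul_eq_mul_integral
      ((hF.indicator hE).mono hD le_rfl).aestronglyMeasurable hv.1
    rw [hv0, mul_zero] at h
    rw [← h, ← integral_indicator hEm]
    refine integral_congr_ae (.of_forall fun ω => ?_)
    by_cases hω : ω ∈ E <;> simp [hω]
  have hsq : ∫ ω in E, v ω ^ 2 ∂μ = μ.real E * q := by
    have h := ((key (fun _ => 1) measurable_const).comp measurable_id
      (measurable_id.pow_const 2 : Measurable fun x : ℝ => x ^ 2)).integral_mul_eq_mul_integral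
      ((measurable_const.indicator hE).mono hD le_rfl).aestronglyMeasurable
      (hv.1.pow 2)
    have h1 : ∫ ω, E.indicator (fun _ => (1 : ℝ)) ω ∂μ = μ.real E := by
      rw [integral_indicator hEm]; simp
    simp only [Function.comp_def, id, h1, hvq] at h
    rw [← h, ← integral_indicator hEm]
    refine integral_congr_ae (.of_forall fun ω => ?_)
    by_cases hω : ω ∈ E <;> simp [hω]
  have hvE : MemLp v 2 (μ.restrict E) := hv.restrict E
  have hexp : ∀ ω, (F ω + c * v ω) ^ 2 = F ω ^ 2 + ((2 * c) * (F ω * v ω) + c ^ 2 * v ω ^ 2) :=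
    fun ω => by ring
  simp_rw [hexp]
  have i1 : Integrable (fun ω => (2 * c) * (F ω * v ω)) (μ.restrict E) :=
    (hF2.integrable_mul hvE).const_mul _
  have i2 : Integrable (fun ω => c ^ 2 * v ω ^ 2) (μ.restrict E) :=
    hvE.integrable_sq.const_mul _
  have i3 : Integrable (fun ω => (2 * c) * (F ω * v ω) + c ^ 2 * v ω ^ 2) (μ.restrict E) :=
    i1.add i2
  rw [integral_add hF2.integrable_sq i3, integral_add i1 i2, integral_const_mul,
    integral_const_mul, hcross, hsq]
  ring

/-- Each `v s` has its own σ-algebra `D s`, which contains all the other terms, so the sum can be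
peeled off one term at a time. -/
lemma setIntegral_add_sum_sq_of_indep [IsProbabilityMeasure μ] {ι : Type*}
    {D : ι → MeasurableSpace Ω} {U : Ω → ℝ} {v : ι → Ω → ℝ} {E : Set Ω} {q : ℝ} (c : ι → ℝ) (S : Finset ι) (hD : ∀ s, D s ≤ mΩ)
    (hind : ∀ s, Indep (MeasurableSpace.comap (v s) inferInstance) (D s) μ)
    (hv : ∀ s, MemLp (v s) 2 μ) (hv0 : ∀ s, ∫ ω, v s ω ∂μ = 0)
    (hvq : ∀ s, ∫ ω, v s ω ^ 2 ∂μ = q) (hvD : ∀ s u, u ≠ s → Measurable[D s] (v u))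
    (hE : ∀ s ∈ S, MeasurableSet[D s] E) (hU : ∀ s ∈ S, Measurable[D s] U)
    (hU2 : MemLp U 2 (μ.restrict E)) :
    ∫ ω in E, (U ω + ∑ s ∈ S, c s * v s ω) ^ 2 ∂μ =
      ∫ ω in E, U ω ^ 2 ∂μ + (∑ s ∈ S, c s ^ 2) * (μ.real E * q) := by
  classical
  induction S using Finset.induction_on with
  | empty => simp
  | insert s S hs ih =>
    have ih' := ih (fun u hu => hE u (Finset.mem_insert_of_mem hu))
      (fun u hu => hU u (Finset.mem_insert_of_mem hu))
    have hstep := setIntegral_add_mul_sq_of_indep (F := fun ω => U ω + ∑ u ∈ S, c u * v u ω)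
      (c s) (hD s) (hind s) (hv s) (hv0 s) (hvq s) (hE s (Finset.mem_insert_self _ _))
      (by
        refine (hU s (Finset.mem_insert_self _ _)).add (Finset.measurable_fun_sum _ fun u hu => ?_)
        exact (hvD s u (by rintro rfl; exact hs hu)).const_mul _)
      (hU2.add (memLp_finsetSum _ fun u _ => ((hv u).restrict E).const_mul _))
    rw [ih'] at hstep
    rw [Finset.sum_insert hs, add_mul, add_comm (c s ^ 2 * _), ← add_assoc, ← hstep]
    refine integral_congr_ae (.of_forall fun ω => ?_)
    simp only [Finset.sum_insert hs]
    ring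

lemma integral_eq_sum_setIntegral_of_le {N : Ω → ℕ} {n : ℕ} (hN : Measurable N)
    (hn : ∀ ω, N ω ≤ n) {f : Ω → ℝ} (hf : Integrable f μ) :
    ∫ ω, f ω ∂μ = ∑ k ∈ Finset.range (n + 1), ∫ ω in N ⁻¹' {k}, f ω ∂μ := by
  rw [← integral_biUnion_finset _ (fun k _ => hN (measurableSet_singleton k)) _
    (fun k _ => hf.integrableOn)]
  · have : ⋃ k ∈ Finset.range (n + 1), N ⁻¹' {k} = Set.univ := by
      ext ω
      simpa using Nat.lt_succ_of_le (hn ω)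
    rw [this, setIntegral_univ]
  · intro a _ b _ hab
    exact Disjoint.preimage _ (by simpa using hab)

end SecondMoment

/-! ### The state process -/

section State

variable {Ω : Type*} {M : ℕ} {A : Matrix (Fin M) (Fin M) ℝ} {x₀ : Ω → EuclideanSpace ℝ (Fin M)}
  {w w' : ℕ → Ω → EuclideanSpace ℝ (Fin M)} {ω : Ω}

lemma state_succ_apply (hA : A.IsDiag) (t : ℕ) (ω : Ω) (j : Fin M) :
    state A x₀ w (t + 1) ω j = A j j * state A x₀ w t ω j + w t ω j := by
  have : A.mulVec (state A x₀ w t ω).ofLp j = A j j * state A x₀ w t ω j := by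
    rw [Matrix.mulVec, dotProduct]
    exact Finset.sum_eq_single j (fun k _ hk => by simp [hA hk.symm]) (by simp)
  simp [state, this]

lemma state_congr {τ : ℕ} (h : ∀ s < τ, w s ω = w' s ω) :
    ∀ t ≤ τ, state A x₀ w t ω = state A x₀ w' t ω
  | 0, _ => rfl
  | t + 1, ht => by simp only [state, state_congr h t (by omega), h t ht]

lemma state_apply_congr (hA : A.IsDiag) {j : Fin M} (h : ∀ s, w s ω j = w' s ω j) (t : ℕ) :
    state A x₀ w t ω j = state A x₀ w' t ω j := by
  induction t with
  | zero => rfl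
  | succ t ih => rw [state_succ_apply hA, state_succ_apply hA, ih, h]

/-- The difference of the two states solves a scalar recursion started from zero at `τ`; a noise
difference in slot `τ + k` is amplified in the `n - 1 - k` later steps. -/
lemma state_apply_eq_add_sum (hA : A.IsDiag) (j : Fin M) {τ : ℕ} (h : ∀ s < τ, w s ω = w' s ω)
    (n : ℕ) :
    state A x₀ w (τ + n) ω j = state A x₀ w' (τ + n) ω j +
      ∑ k ∈ Finset.range n, A j j ^ (n - 1 - k) * (w (τ + k) ω j - w' (τ + k) ω j) := by
  induction n with
  | zero => simp [state_congr h]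
  | succ n ih =>
    rw [← add_assoc, state_succ_apply hA, state_succ_apply hA, ih, Finset.sum_range_succ, mul_add,
      Finset.mul_sum]
    have : ∀ k ∈ Finset.range n, A j j * (A j j ^ (n - 1 - k) *
        (w (τ + k) ω j - w' (τ + k) ω j)) =
        A j j ^ (n + 1 - 1 - k) * (w (τ + k) ω j - w' (τ + k) ω j) := fun k hk => by
      have hk' := Finset.mem_range.1 hk
      rw [← mul_assoc, ← pow_succ', show n - 1 - k + 1 = n + 1 - 1 - k by omega]
    rw [Finset.sum_congr rfl this]
    simp
    ring

lemma measurable_state [MeasurableSpace Ω] (hx₀ : Measurable x₀) (hw : ∀ s, Measurable (w s))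
    (t : ℕ) : Measurable (state A x₀ w t) := by
  induction t with
  | zero => exact hx₀
  | succ t ih =>
    have : Measurable fun z : EuclideanSpace ℝ (Fin M) => WithLp.toLp 2 (A.mulVec z.ofLp) :=
      (Matrix.toEuclideanCLM (𝕜 := ℝ) A).continuous.measurable
    exact (this.comp ih).add (hw t)

lemma memLp_state [MeasurableSpace Ω] {μ : Measure Ω} (hx₀ : MemLp x₀ 2 μ)
    (hw : ∀ s, MemLp (w s) 2 μ) (t : ℕ) : MemLp (state A x₀ w t) 2 μ := by
  induction t with
  | zero => exact hx₀
  | succ t ih => exact ((Matrix.toEuclideanCLM (𝕜 := ℝ) A).comp_memLp' ih).add (hw t)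

end State

/-! ### The monitor's observations -/

section Observation

variable {Ω 𝒱 : Type*} [MeasurableSpace 𝒱] {M : ℕ} {π : ObliviousPolicy M 𝒱} {V : Ω → 𝒱}
  {xinit : Ω → EuclideanSpace ℝ (Fin M)} {x x' : ℕ → Ω → EuclideanSpace ℝ (Fin M)}

lemma age_le (i : Fin M) (t : ℕ) (ω : Ω) : age π V xinit x i t ω ≤ t := by
  induction t with
  | zero => rfl
  | succ t ih => simp only [age]; split_ifs <;> omega

/-- Before sensor `i` is sampled again, changing its coordinate is not noticed. -/
lemma history_eq_and_age_eq {i : Fin M} {τ : ℕ} {ω : Ω} (h₁ : ∀ s ≤ τ, x s ω = x' s ω)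
    (h₂ : ∀ j ≠ i, ∀ s, x s ω j = x' s ω j) (t : ℕ) (ht : t ≤ age π V xinit x i t ω + τ) :
    history π V xinit x (t + 1) ω = history π V xinit x' (t + 1) ω ∧
      age π V xinit x i t ω = age π V xinit x' i t ω := by
  have step : ∀ s, history π V xinit x s ω = history π V xinit x' s ω →
      x s ω (scheduled π V xinit x s ω) = x' s ω (scheduled π V xinit x s ω) →
      history π V xinit x (s + 1) ω = history π V xinit x' (s + 1) ω := by
    intro s hs hx
    simp only [scheduled, hs] at hx
    simp only [history, hs, hx]
  induction t with
  | zero => exact ⟨step 0 rfl (by rw [h₁ 0 (Nat.zero_le _)]), rfl⟩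
  | succ t ih =>
    obtain ⟨ih₁, ih₂⟩ : history π V xinit x (t + 1) ω = history π V xinit x' (t + 1) ω ∧
        age π V xinit x i t ω = age π V xinit x' i t ω := by
      -- If the age is reset in slot `t + 1`, then `ht` forces `t + 1 ≤ τ`; otherwise both sides of
      -- `ht` drop by one.
      refine ih ?_
      simp only [age] at ht
      split_ifs at ht <;> omega
    have hsch : scheduled π V xinit x (t + 1) ω = scheduled π V xinit x' (t + 1) ω := by
      simp only [scheduled, ih₁]
    refine ⟨step _ ih₁ ?_, by simp only [age, hsch, ih₂]⟩
    -- Up to `τ` the whole states agree; after `τ`, scheduling `i` would reset the age and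
    -- contradict `ht`.
    rcases le_or_gt (t + 1) τ with hτ | hτ
    · rw [h₁ _ hτ]
    · refine h₂ _ (fun hi => ?_) _
      simp only [age, if_pos hi] at ht
      omega

variable [MeasurableSpace Ω]

lemma measurable_history (hV : Measurable V) (hxinit : Measurable xinit)
    (hx : ∀ s, Measurable (x s)) (t : ℕ) : Measurable (history π V xinit x t) := by
  induction t with
  | zero => exact measurable_const
  | succ t ih =>
    have hs : Measurable fun ω => π.rule t (V ω, xinit ω, history π V xinit x t ω) :=
      (π.measurable_rule t).comp (hV.prodMk (hxinit.prodMk ih))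
    have hy : Measurable fun ω =>
        x t ω (π.rule t (V ω, xinit ω, history π V xinit x t ω)) := by
      have : Measurable fun z : EuclideanSpace ℝ (Fin M) × Fin M => z.1 z.2 :=
        measurable_from_prod_countable_left fun j =>
          (EuclideanSpace.proj (𝕜 := ℝ) j).continuous.measurable
      exact this.comp ((hx t).prodMk hs)
    refine measurable_pi_lambda _ fun k => ?_
    refine Fin.lastCases ?_ (fun k => ?_) k
    · simpa [history] using hs.prodMk hy
    · simpa [history, Function.comp_def] using (measurable_pi_apply k).comp ih

lemma measurable_scheduled (hV : Measurable V) (hxinit : Measurable xinit)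
    (hx : ∀ s, Measurable (x s)) (t : ℕ) : Measurable (scheduled π V xinit x t) :=
  (π.measurable_rule t).comp (hV.prodMk (hxinit.prodMk (measurable_history hV hxinit hx t)))

lemma measurable_age (hV : Measurable V) (hxinit : Measurable xinit)
    (hx : ∀ s, Measurable (x s)) (i : Fin M) (t : ℕ) : Measurable (age π V xinit x i t) := by
  induction t with
  | zero => exact measurable_const
  | succ t ih =>
    exact Measurable.ite (measurable_scheduled hV hxinit hx (t + 1) (measurableSet_singleton i))
      measurable_const (ih.add_const 1)

end Observation

/-! ### The noise with the innovation of one sensor removed -/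

section Innovation

variable {Ω 𝒱 : Type*} [MeasurableSpace 𝒱] {M : ℕ} {V : Ω → 𝒱}
  {x₀ xinit : Ω → EuclideanSpace ℝ (Fin M)} {w : ℕ → Ω → EuclideanSpace ℝ (Fin M)}
  {p : EuclideanSpace ℝ (Fin M)} {i : Fin M}

/-- Everything except the innovation `⟪p, w s⟫` of sensor `i` in slot `s`. -/
@[reducible] noncomputable def exceptInnovation (V : Ω → 𝒱)
    (x₀ xinit : Ω → EuclideanSpace ℝ (Fin M))
    (w : ℕ → Ω → EuclideanSpace ℝ (Fin M)) (p : EuclideanSpace ℝ (Fin M)) (i : Fin M) (s : ℕ) :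
    MeasurableSpace Ω :=
  MeasurableSpace.comap (fun ω => (((residual p i (w s ω), fun u : {u : ℕ // u ≠ s} => w u ω),
    (x₀ ω, xinit ω)), V ω)) inferInstance

/-- The noise process whose innovations at sensor `i` are removed from slot `τ` on. -/
noncomputable def truncatedNoise (w : ℕ → Ω → EuclideanSpace ℝ (Fin M))
    (p : EuclideanSpace ℝ (Fin M)) (i : Fin M) (τ s : ℕ) (ω : Ω) : EuclideanSpace ℝ (Fin M) :=
  if s < τ then w s ω else residual p i (w s ω)

lemma truncatedNoise_apply_of_ne {j : Fin M} (hj : j ≠ i) (τ s : ℕ) (ω : Ω) :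
    truncatedNoise w p i τ s ω j = w s ω j := by
  rw [truncatedNoise]
  split_ifs
  · rfl
  · simp [residual_apply, hj]

lemma sub_truncatedNoise_apply_self {τ s : ℕ} (h : τ ≤ s) (ω : Ω) :
    w s ω i - truncatedNoise w p i τ s ω i = inner ℝ p (w s ω) := by
  rw [truncatedNoise, if_neg (by omega)]
  simp [residual_apply]

lemma measurable_exceptInnovation (s : ℕ) :
    Measurable[exceptInnovation V x₀ xinit w p i s]
      (fun ω => (((residual p i (w s ω), fun u : {u : ℕ // u ≠ s} => w u ω),
        (x₀ ω, xinit ω)), V ω)) :=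
  comap_measurable _

lemma measurable_noise_of_ne {s u : ℕ} (h : u ≠ s) :
    Measurable[exceptInnovation V x₀ xinit w p i s] (w u) :=
  (measurable_pi_apply (⟨u, h⟩ : {u : ℕ // u ≠ s})).comp
    (measurable_snd.comp (measurable_fst.comp (measurable_fst.comp (measurable_exceptInnovation s))))

/-- In slot `s` itself the truncated noise uses only the residual, which is where `τ ≤ s` enters. -/
lemma measurable_truncatedNoise {τ s : ℕ} (h : τ ≤ s) (u : ℕ) :
    Measurable[exceptInnovation V x₀ xinit w p i s] (truncatedNoise w p i τ u) := by
  by_cases hu : u < τ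
  · have : truncatedNoise w p i τ u = w u := by funext ω; simp [truncatedNoise, hu]
    rw [this]
    exact measurable_noise_of_ne (by omega)
  · have : truncatedNoise w p i τ u = fun ω => residual p i (w u ω) := by
      funext ω; simp [truncatedNoise, hu]
    rw [this]
    rcases eq_or_ne u s with rfl | hus
    · exact measurable_fst.comp
        (measurable_fst.comp (measurable_fst.comp (measurable_exceptInnovation u)))
    · exact (residual p i).continuous.measurable.comp (measurable_noise_of_ne hus)

lemma measurable_truncatedState (A : Matrix (Fin M) (Fin M) ℝ) {τ s : ℕ} (h : τ ≤ s) (u : ℕ) :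
    Measurable[exceptInnovation V x₀ xinit w p i s]
      (state A x₀ (truncatedNoise w p i τ) u) :=
  -- The general measurability lemma is applied with the smaller σ-algebra `exceptInnovation` on
  -- `Ω`.
  @measurable_state Ω M A x₀ _ (_)
    (measurable_fst.comp (measurable_snd.comp (measurable_fst.comp (measurable_exceptInnovation s))))
    (measurable_truncatedNoise h) u

lemma measurable_truncatedHistory (π : ObliviousPolicy M 𝒱) (A : Matrix (Fin M) (Fin M) ℝ)
    {τ s : ℕ} (h : τ ≤ s) (u : ℕ) :
    Measurable[exceptInnovation V x₀ xinit w p i s]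
      (fun ω => (xinit ω, history π V xinit (state A x₀ (truncatedNoise w p i τ)) u ω)) := by
  have hxi : Measurable[exceptInnovation V x₀ xinit w p i s] xinit :=
    measurable_snd.comp (measurable_snd.comp (measurable_fst.comp (measurable_exceptInnovation s)))
  exact hxi.prodMk (@measurable_history Ω 𝒱 _ M π V xinit _ (_)
    (measurable_snd.comp (measurable_exceptInnovation s)) hxi (measurable_truncatedState A h) u)

lemma measurable_truncatedAge (π : ObliviousPolicy M 𝒱) (A : Matrix (Fin M) (Fin M) ℝ)
    {τ s : ℕ} (h : τ ≤ s) (j : Fin M) (u : ℕ) :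
    Measurable[exceptInnovation V x₀ xinit w p i s]
      (age π V xinit (state A x₀ (truncatedNoise w p i τ)) j u) :=
  @measurable_age Ω 𝒱 _ M π V xinit _ (_)
    (measurable_snd.comp (measurable_exceptInnovation s))
    (measurable_snd.comp (measurable_snd.comp (measurable_fst.comp (measurable_exceptInnovation s))))
    (measurable_truncatedState A h) j u

variable {mΩ : MeasurableSpace Ω} {μ : Measure Ω} 

lemma exceptInnovation_le (hV : Measurable V) (hx₀ : Measurable x₀) (hxinit : Measurable xinit)
    (hw : ∀ t, Measurable (w t)) (s : ℕ) : exceptInnovation V x₀ xinit w p i s ≤ mΩ :=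
  Measurable.comap_le (by fun_prop)

lemma indep_innovation [IsProbabilityMeasure μ] {Q : Matrix (Fin M) (Fin M) ℝ} {c : ℝ}
    (hQ : Q.PosSemidef) (hpi : p i = 1) (hp : Q *ᵥ p.ofLp = Pi.single i c)
    (hx₀ : Measurable x₀) (hxinit : Measurable xinit) (hw : ∀ t, Measurable (w t))
    (hV : Measurable V) (hw_law : ∀ t, μ.map (w t) = multivariateGaussian 0 Q)
    (hw_indep : iIndepFun w μ)
    (hw_init : IndepFun (fun ω => (x₀ ω, xinit ω)) (fun ω => fun t : ℕ => w t ω) μ)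
    (hV_indep : IndepFun V (fun ω => (x₀ ω, xinit ω, fun t : ℕ => w t ω)) μ) (s : ℕ) :
    Indep (MeasurableSpace.comap (fun ω => inner ℝ p (w s ω)) inferInstance)
      (exceptInnovation V x₀ xinit w p i s) μ := by
  have h₁ := indepFun_inner_residual hQ hpi hp (hw s) (hw_law s)
  have h₂ : IndepFun (fun ω => (inner ℝ p (w s ω), residual p i (w s ω)))
      (fun ω (u : {u : ℕ // u ≠ s}) => w u ω) μ :=
    (iIndepFun.indepFun_compl hw hw_indep s).comp
      (φ := fun z => (inner ℝ p z, residual p i z)) (by fun_prop) measurable_id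
  have h₃ := IndepFun.prodMk_right_of_prodMk_left (by fun_prop) (by fun_prop) (by fun_prop) h₁ h₂
  have h₄ : IndepFun (fun ω => (inner ℝ p (w s ω),
      (residual p i (w s ω), fun u : {u : ℕ // u ≠ s} => w u ω)))
      (fun ω => (x₀ ω, xinit ω)) μ :=
    hw_init.symm.comp (φ := fun z : ℕ → EuclideanSpace ℝ (Fin M) =>
      (inner ℝ p (z s), (residual p i (z s), fun u : {u : ℕ // u ≠ s} => z u)))
      (by fun_prop) measurable_id
  have h₅ := IndepFun.prodMk_right_of_prodMk_left (by fun_prop) (by fun_prop) (by fun_prop) h₃ h₄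
  have h₆ : IndepFun (fun ω => (inner ℝ p (w s ω),
      ((residual p i (w s ω), fun u : {u : ℕ // u ≠ s} => w u ω), (x₀ ω, xinit ω)))) V μ :=
    hV_indep.symm.comp (φ := fun z : EuclideanSpace ℝ (Fin M) × EuclideanSpace ℝ (Fin M) ×
      (ℕ → EuclideanSpace ℝ (Fin M)) => (inner ℝ p (z.2.2 s),
      ((residual p i (z.2.2 s), fun u : {u : ℕ // u ≠ s} => z.2.2 u), (z.1, z.2.1))))
      (by fun_prop) measurable_id
  exact IndepFun.prodMk_right_of_prodMk_left (by fun_prop) (by fun_prop) hV h₅ h₆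

end Innovation

/-! ### The error on the event that the age takes a given value -/

section Error

variable {Ω 𝒱 : Type*} [MeasurableSpace Ω] [MeasurableSpace 𝒱] {μ : Measure Ω}
  {M : ℕ} {A Q : Matrix (Fin M) (Fin M) ℝ}
  {x₀ xinit : Ω → EuclideanSpace ℝ (Fin M)} {w : ℕ → Ω → EuclideanSpace ℝ (Fin M)} {V : Ω → 𝒱}

lemma memLp_sub_estimate (hx₀2 : MemLp x₀ 2 μ) (hw : ∀ t : ℕ, Measurable (w t))
    (hw_law : ∀ t : ℕ, μ.map (w t) = multivariateGaussian 0 Q) (π : ObliviousPolicy M 𝒱)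
    (i : Fin M) (t : ℕ) :
    MemLp (fun ω => state A x₀ w t ω i - estimate μ π V xinit (state A x₀ w) t i ω) 2 μ := by
  have hx : MemLp (fun ω => state A x₀ w t ω i) 2 μ :=
    (EuclideanSpace.proj (𝕜 := ℝ) i).comp_memLp'
      (memLp_state hx₀2 (fun s => (hasGaussianLaw_of_map_eq (hw s) (hw_law s)).memLp_two) t)
  exact hx.sub (hx.condExp (by norm_num))

lemma qTilde_mul_le_setIntegral_age_eq [IsProbabilityMeasure μ] (hA : A.IsDiag) (hQ : Q.PosDef)
    (hx₀ : Measurable x₀) (hx₀2 : MemLp x₀ 2 μ) (hxinit : Measurable xinit)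
    (hw : ∀ t : ℕ, Measurable (w t)) (hV : Measurable V)
    (hw_law : ∀ t : ℕ, μ.map (w t) = multivariateGaussian 0 Q) (hw_indep : iIndepFun w μ)
    (hw_init : IndepFun (fun ω => (x₀ ω, xinit ω)) (fun ω => fun t : ℕ => w t ω) μ)
    (hV_indep : IndepFun V (fun ω => (x₀ ω, xinit ω, fun t : ℕ => w t ω)) μ)
    (π : ObliviousPolicy M 𝒱) (i : Fin M) {t n : ℕ} (hn : n ≤ t) :
    qTilde Q i * (μ.real (age π V xinit (state A x₀ w) i t ⁻¹' {n}) *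
        ∑ k ∈ Finset.range n, A i i ^ (2 * k)) ≤
      ∫ ω in age π V xinit (state A x₀ w) i t ⁻¹' {n},
        (state A x₀ w t ω i - estimate μ π V xinit (state A x₀ w) t i ω) ^ 2 ∂μ := by
  obtain ⟨p, hpi, hp⟩ := exists_mulVec_eq_single_qTilde hQ i
  -- `τ` is the slot in which an age of `n` was last zero; for `n = t` it is slot `0`, where the age
  -- vanishes whichever sensor is scheduled.
  obtain ⟨τ, rfl⟩ := Nat.exists_eq_add_of_le' hn
  set x := state A x₀ w with hx
  set w' := truncatedNoise w p i τ with hw'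
  set x' := state A x₀ w' with hx'
  set E := age π V xinit x i (τ + n) ⁻¹' {n} with hE
  have hww' : ∀ ω, ∀ s < τ, w s ω = w' s ω := fun ω s hs => by
    simp [hw', truncatedNoise, hs]
  have heq₁ : ∀ ω, ∀ s ≤ τ, x s ω = x' s ω := fun ω s hs => state_congr (hww' ω) s hs
  have heq₂ : ∀ ω, ∀ j ≠ i, ∀ s, x s ω j = x' s ω j := fun ω j hj s =>
    state_apply_congr hA (fun u => (truncatedNoise_apply_of_ne hj τ u ω).symm) s
  have hdiff : ∀ ω, x (τ + n) ω i = x' (τ + n) ω i +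
      ∑ k ∈ Finset.range n, A i i ^ (n - 1 - k) * inner ℝ p (w (τ + k) ω) := fun ω => by
    rw [hx, state_apply_eq_add_sum hA i (hww' ω) n]
    simp_rw [hw', sub_truncatedNoise_apply_self (Nat.le_add_right τ _), hx', hw']
  have hEE' : E = age π V xinit x' i (τ + n) ⁻¹' {n} := by
    ext ω
    simp only [hE, Set.mem_preimage, Set.mem_singleton_iff]
    constructor <;> intro h
    · rw [← (history_eq_and_age_eq (heq₁ ω) (heq₂ ω) _ (by omega)).2, h]
    · rw [← (history_eq_and_age_eq (fun s hs => (heq₁ ω s hs).symm)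
        (fun j hj s => (heq₂ ω j hj s).symm) _ (by omega)).2, h]
  have hEm : MeasurableSet E :=
    measurable_age hV hxinit (measurable_state hx₀ hw) i _ (measurableSet_singleton n)
  -- By Doob–Dynkin the estimate is a function `g` of the received data, so `g` can also be fed the
  -- data of the modified system.
  obtain ⟨g, hg, hest⟩ := Measurable.exists_eq_measurable_comp
    (f := fun ω => (xinit ω, history π V xinit x (τ + n + 1) ω))
    (g := estimate μ π V xinit x (τ + n) i) stronglyMeasurable_condExp.measurable
  set U : Ω → ℝ := fun ω => x' (τ + n) ω i - g (xinit ω, history π V xinit x' (τ + n + 1) ω)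
    with hU
  have herr : ∀ ω ∈ E, x (τ + n) ω i - estimate μ π V xinit x (τ + n) i ω =
      U ω + ∑ k ∈ Finset.range n, A i i ^ (n - 1 - k) * inner ℝ p (w (τ + k) ω) := by
    intro ω hω
    have hage : age π V xinit x i (τ + n) ω = n := hω
    rw [hest, hdiff, Function.comp_apply,
      (history_eq_and_age_eq (heq₁ ω) (heq₂ ω) (τ + n) (by omega)).1]
    simp only [hU]
    ring
  have hv : ∀ k, MemLp (fun ω => inner ℝ p (w (τ + k) ω)) 2 μ := fun k =>
    memLp_inner_of_map_eq (hw _) (hw_law _) p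
  -- Off `E` there is no control of `g` at the modified data; on `E`, `U` is the true error minus
  -- the innovation sum.
  have hU2 : MemLp U 2 (μ.restrict E) := by
    have herrE : MemLp (fun ω => x (τ + n) ω i - estimate μ π V xinit x (τ + n) i ω) 2
        (μ.restrict E) := (memLp_sub_estimate hx₀2 hw hw_law π i (τ + n)).restrict E
    refine (herrE.sub (memLp_finsetSum (Finset.range n) fun k _ =>
      ((hv k).restrict E).const_mul (A i i ^ (n - 1 - k)))).ae_eq ?_
    filter_upwards [ae_restrict_mem hEm] with ω hω
    exact sub_eq_of_eq_add (herr ω hω)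
  have hmain := setIntegral_add_sum_sq_of_indep (q := qTilde Q i) (U := U)
    (D := fun k => exceptInnovation V x₀ xinit w p i (τ + k))
    (v := fun k ω => inner ℝ p (w (τ + k) ω)) (fun k => A i i ^ (n - 1 - k)) (Finset.range n)
    (fun k => exceptInnovation_le hV hx₀ hxinit hw _)
    (fun k => indep_innovation hQ.posSemidef hpi hp hx₀ hxinit hw hV hw_law hw_indep hw_init
      hV_indep _)
    hv (fun k => integral_inner_of_map_eq (hw _) (hw_law _) p)
    (fun k => integral_inner_sq_of_map_eq hQ.posSemidef hpi hp (hw _) (hw_law _))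
    (fun k u hu => (innerSL ℝ p).continuous.measurable.comp
      (measurable_noise_of_ne (by omega : τ + u ≠ τ + k)))
    (fun k _ => by
      rw [hEE']
      exact measurable_truncatedAge π A (Nat.le_add_right τ k) i _ (measurableSet_singleton n))
    (fun k _ => ((EuclideanSpace.proj (𝕜 := ℝ) i).continuous.measurable.comp
      (measurable_truncatedState A (Nat.le_add_right τ k) (τ + n))).sub
      (hg.comp (measurable_truncatedHistory π A (Nat.le_add_right τ k) _)))
    hU2
  have hsum : ∑ k ∈ Finset.range n, (A i i ^ (n - 1 - k)) ^ 2 =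
      ∑ k ∈ Finset.range n, A i i ^ (2 * k) := by
    rw [← Finset.sum_range_reflect (fun k => A i i ^ (2 * k))]
    exact Finset.sum_congr rfl fun k _ => by rw [← pow_mul, mul_comm]
  rw [setIntegral_congr_fun hEm fun ω hω => congrArg (· ^ 2) (herr ω hω), hmain, hsum]
  have hpos : 0 ≤ ∫ ω in E, U ω ^ 2 ∂μ := integral_nonneg fun ω => sq_nonneg _
  linarith

end Error

end Monitoring

/-! ### Summation over the values of the age -/

theorem theorem8 {Ω 𝒱 : Type*} [MeasurableSpace Ω] [MeasurableSpace 𝒱]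
    (μ : Measure Ω) [IsProbabilityMeasure μ] {M : ℕ}
    (A Q : Matrix (Fin M) (Fin M) ℝ) (hA : A.IsDiag) (hA1 : ∀ j : Fin M, 1 ≤ A j j)
    (hQ : Q.PosDef)
    (x₀ xinit : Ω → EuclideanSpace ℝ (Fin M)) (w : ℕ → Ω → EuclideanSpace ℝ (Fin M))
    (V : Ω → 𝒱)
    (hx₀ : Measurable x₀) (hx₀2 : MemLp x₀ 2 μ) (hxinit : Measurable xinit)
    (hw : ∀ t : ℕ, Measurable (w t)) (hV : Measurable V)
    (hw_law : ∀ t : ℕ, μ.map (w t) = multivariateGaussian 0 Q)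
    (hw_indep : iIndepFun w μ)
    (hw_init : IndepFun (fun ω => (x₀ ω, xinit ω)) (fun ω => fun t : ℕ => w t ω) μ)
    (hV_indep : IndepFun V (fun ω => (x₀ ω, xinit ω, fun t : ℕ => w t ω)) μ)
    (π : Monitoring.ObliviousPolicy M 𝒱)
    (x : ℕ → Ω → EuclideanSpace ℝ (Fin M)) (hx : x = Monitoring.state A x₀ w)
    (h : Fin M → ℕ → Ω → ℕ) (hh : h = Monitoring.age π V xinit x)
    (i : Fin M) (t : ℕ) :
    Integrable (fun ω => (x t ω i - Monitoring.estimate μ π V xinit x t i ω) ^ 2) μ ∧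
    Integrable (fun ω => ∑ k ∈ Finset.range (h i t ω), A i i ^ (2 * k)) μ ∧
    Monitoring.qTilde Q i * ∫ ω, ∑ k ∈ Finset.range (h i t ω), A i i ^ (2 * k) ∂μ ≤
      ∫ ω, (x t ω i - Monitoring.estimate μ π V xinit x t i ω) ^ 2 ∂μ ∧
    (A i i = 1 →
      Monitoring.qTilde Q i * ∫ ω, ∑ k ∈ Finset.range (h i t ω), A i i ^ (2 * k) ∂μ =
        Monitoring.qTilde Q i * ∫ ω, (h i t ω : ℝ) ∂μ) ∧
    (1 < A i i →
      Monitoring.qTilde Q i * ∫ ω, ∑ k ∈ Finset.range (h i t ω), A i i ^ (2 * k) ∂μ =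
        Monitoring.qTilde Q i *
          ∫ ω, (A i i ^ (2 * h i t ω) - 1) / (A i i ^ 2 - 1) ∂μ) := by
  subst hx hh
  have hage : Measurable (Monitoring.age π V xinit (Monitoring.state A x₀ w) i t) :=
    Monitoring.measurable_age hV hxinit (Monitoring.measurable_state hx₀ hw) i t
  have herr : Integrable (fun ω => (Monitoring.state A x₀ w t ω i -
      Monitoring.estimate μ π V xinit (Monitoring.state A x₀ w) t i ω) ^ 2) μ :=
    (Monitoring.memLp_sub_estimate hx₀2 hw hw_law π i t).integrable_sq
  have hsum : Integrable (fun ω => ∑ k ∈ Finset.range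
      (Monitoring.age π V xinit (Monitoring.state A x₀ w) i t ω), A i i ^ (2 * k)) μ := by
    -- The age never exceeds `t`, so the sum is a bounded random variable.
    refine Integrable.of_bound (C := ∑ k ∈ Finset.range t, A i i ^ (2 * k))
      (((measurable_of_countable fun n : ℕ => ∑ k ∈ Finset.range n, A i i ^ (2 * k)).comp
        hage).aestronglyMeasurable) (.of_forall fun ω => ?_)
    have hnonneg : ∀ k, 0 ≤ A i i ^ (2 * k) := fun k => by
      have := hA1 i
      positivity
    rw [Real.norm_of_nonneg (Finset.sum_nonneg fun k _ => hnonneg k)]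
    exact Finset.sum_le_sum_of_subset_of_nonneg
      (Finset.range_mono (Monitoring.age_le i t ω)) fun k _ _ => hnonneg k
  refine ⟨herr, hsum, ?_, fun h1 => by simp [h1], fun h1 => ?_⟩
  · rw [Monitoring.integral_eq_sum_setIntegral_of_le hage (Monitoring.age_le i t) hsum,
      Monitoring.integral_eq_sum_setIntegral_of_le hage (Monitoring.age_le i t) herr,
      Finset.mul_sum]
    refine Finset.sum_le_sum fun n hn => ?_
    rw [setIntegral_congr_fun (hage (measurableSet_singleton n))
      (g := fun _ => ∑ k ∈ Finset.range n, A i i ^ (2 * k)) fun ω hω => by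
        simp only [Set.mem_preimage, Set.mem_singleton_iff] at hω; simp only [hω],
      setIntegral_const, smul_eq_mul]
    exact Monitoring.qTilde_mul_le_setIntegral_age_eq hA hQ hx₀ hx₀2 hxinit hw hV hw_law hw_indep
      hw_init hV_indep π i (Nat.lt_succ_iff.1 (Finset.mem_range.1 hn))
  · congr 2
    funext ω
    have hne : A i i ^ 2 ≠ 1 := (one_lt_pow₀ h1 two_ne_zero).ne'
    simp_rw [pow_mul]
    rw [geom_sum_eq hne]
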